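/- Every $x\in(0,1]$ has a unique Lüroth expansion $x=\sum_{k\ge1}\frac{1}{s_1\cdots s_{k-1}\,d_k}$ with integers $d_j=d_j(x)\ge 2$ and $s_j=d_j(d_j-1)$. Let $D_n=d_n(\cdot)$, $n\ge1$, be the digits, viewed as random variables on $[0,1]$ with Lebesgue measure $P$. Let $\{F_n\}_{n\ge1}$ be distribution functions on $[0,1]$ with $F_n(0)=0$ such that $R_n=D_{n+1}-1$ is an Oppenheim expansion relative to $\{F_n\}$ with $\Theta_n=D_n-1$, $\varphi_n\equiv1$, $Q_n\equiv0$, i.e. for all $n\ge 1$ and all positive integers $h_1,\dots,h_{n+1}$ $$P(D_{n+1}-1=h_{n+1}\mid D_n-1=h_n,\dots,D_1-1=h_1)=F_n\Big(\frac1{h_{n+1}}\Big)-F_n\Big(\frac1{h_{n+1}+1}\Big)$$ whenever the conditioning event has positive probability. Assume that there are positive reals $\alpha_n$ with $0<\liminf\alpha_n\le\limsup\alpha_n<\infty$ such that (i) $\displaystyle\lim_{t\to0^+}\sup_{n}\Big|\frac{F_n(t)}{t}-\alpha_n\Big|=0$; (ii) $\displaystyle\lim_{t\to0^+}\sup_n\int_0^t\frac1u\Big|\frac{F_n(u)}{u}-\alpha_n\Big|\,du=0$.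 Let $\{a_{k,n}\}_{1\le k\le n}$ be an array of positive numbers and $\{\rho_n\}$ a real sequence with $\rho_n\log n\to+\infty$ such that $$\limsup_{n\to\infty}\frac{\sum_{k=1}^n\alpha_ka_{k,n}|\log(\alpha_ka_{k,n})|}{\rho_n\log n}<\infty,\qquad \lim_{n\to\infty}\frac{\sum_{k=1}^n\alpha_ka_{k,n}\log(\alpha_ka_{k,n})}{\rho_n\log n}=-\ell\in\mathbb R,$$ and $n\mapsto\sum_{k=1}^n\alpha_ka_{k,n}$ is bounded. Then $$\frac1{\rho_n\log n}\sum_{k=1}^na_{k,n}D_{k+1}\longrightarrow\ell\quad\text{in probability as } n\to\infty .$$ Moreover, the assumptions on $\{F_n\}$ are satisfied by the uniform distribution functions $F_n(x)=x$, $0\le x\le1$, with $\alpha_n=1$. -/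

import Mathlib

open MeasureTheory ProbabilityTheory Filter Topology

noncomputable section

/-! ### Lüroth expansion -/

/-- The first Lüroth digit of `x ∈ (0,1]`: the integer `d ≥ 2` with `1/d < x ≤ 1/(d-1)`. -/
def lurothFirstDigit (x : ℝ) : ℕ := ⌊1 / x⌋₊ + 1

/-- The Lüroth map: `x = 1/d + lurothMap x / (d (d-1))`, where `d` is the first digit of `x`. -/
def lurothMap (x : ℝ) : ℝ :=
  (lurothFirstDigit x : ℝ) * ((lurothFirstDigit x : ℝ) - 1) * (x - 1 / (lurothFirstDigit x : ℝ))

/-- The `n`-th Lüroth digit `D_n(x)`, for `n ≥ 1` (the value at `n = 0` is not used). -/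
def lurothDigit (n : ℕ) (x : ℝ) : ℕ := lurothFirstDigit (lurothMap^[n - 1] x)

/-- Lebesgue measure on `[0,1]`. -/
def lebesgue01 : Measure ℝ := volume.restrict (Set.Icc 0 1)

theorem lurothFirstDigit_spec {x : ℝ} (hx : x ∈ Set.Ioc (0 : ℝ) 1) :
    2 ≤ lurothFirstDigit x ∧ 1 / (lurothFirstDigit x : ℝ) < x ∧
      x ≤ 1 / ((lurothFirstDigit x : ℝ) - 1) := by
  obtain ⟨h0, h1⟩ := hx
  have h2 : (1 : ℝ) ≤ 1 / x := by rw [le_div_iff₀ h0]; linarith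
  have h3 : 1 ≤ ⌊1 / x⌋₊ := by rw [Nat.one_le_floor_iff]; exact h2
  have h3' : (1 : ℝ) ≤ (⌊1 / x⌋₊ : ℝ) := by exact_mod_cast h3
  refine ⟨by unfold lurothFirstDigit; omega, ?_, ?_⟩
  · have h4 := Nat.lt_floor_add_one (1 / x)
    unfold lurothFirstDigit
    push_cast
    rw [div_lt_iff₀ h0] at h4
    rw [div_lt_iff₀ (by linarith)]
    linarith
  · have h4 := Nat.floor_le (show (0 : ℝ) ≤ 1 / x by positivity)
    unfold lurothFirstDigit
    push_cast
    rw [le_div_iff₀ h0] at h4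
    rw [le_div_iff₀ (by linarith)]
    linarith

theorem lurothMap_mem {x : ℝ} (hx : x ∈ Set.Ioc (0 : ℝ) 1) :
    lurothMap x ∈ Set.Ioc (0 : ℝ) 1 := by
  obtain ⟨h2, hl, hu⟩ := lurothFirstDigit_spec hx
  have h2' : (2 : ℝ) ≤ (lurothFirstDigit x : ℝ) := by exact_mod_cast h2
  unfold lurothMap
  generalize (lurothFirstDigit x : ℝ) = d at *
  constructor
  · have : 0 < x - 1 / d := by linarith
    have : 0 < d - 1 := by linarith
    positivity
  · rw [le_div_iff₀ (by linarith)] at hu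
    have e : d * (d - 1) * (x - 1 / d) = d * (x * (d - 1)) - (d - 1) := by
      field_simp
    rw [e]
    nlinarith

theorem lurothMap_iterate_mem {x : ℝ} (hx : x ∈ Set.Ioc (0 : ℝ) 1) (n : ℕ) :
    lurothMap^[n] x ∈ Set.Ioc (0 : ℝ) 1 := by
  induction n with
  | zero => exact hx
  | succ k ih => rw [Function.iterate_succ_apply']; exact lurothMap_mem ih

/-- The digits are `≥ 2` and represent `x`: with `s_h = d_h (d_h - 1)`,
`x = ∑_{k ≥ 0} 1 / (s_1 ⋯ s_k d_{k+1})`. -/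
theorem lurothDigit_expansion {x : ℝ} (hx : x ∈ Set.Ioc (0 : ℝ) 1) :
    (∀ n, 2 ≤ lurothDigit n x) ∧
    HasSum (fun k : ℕ => 1 / ((∏ h ∈ Finset.Icc 1 k,
      ((lurothDigit h x : ℝ) * ((lurothDigit h x : ℝ) - 1))) * (lurothDigit (k + 1) x : ℝ))) x := by
  have hd : ∀ n, 2 ≤ lurothDigit n x := fun n =>
    (lurothFirstDigit_spec (lurothMap_iterate_mem hx (n - 1))).1
  have hd' : ∀ n, (2 : ℝ) ≤ (lurothDigit n x : ℝ) := fun n => by exact_mod_cast hd n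
  refine ⟨hd, ?_⟩
  set s : ℕ → ℝ := fun h => (lurothDigit h x : ℝ) * ((lurothDigit h x : ℝ) - 1) with hs
  have hs2 : ∀ h, 2 ≤ s h := fun h => by
    have := hd' h
    simp only [hs]
    nlinarith
  have hP : ∀ N : ℕ, (2 : ℝ) ^ N ≤ ∏ h ∈ Finset.Icc 1 N, s h := by
    intro N
    induction N with
    | zero => simp
    | succ k ih =>
      rw [Finset.prod_Icc_succ_top (by omega), pow_succ]
      exact mul_le_mul ih (hs2 _) (by norm_num) (le_trans (by positivity) ih)
  have hPpos : ∀ N : ℕ, 0 < ∏ h ∈ Finset.Icc 1 N, s h := fun N =>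
    lt_of_lt_of_le (by positivity) (hP N)
  have hstep : ∀ k : ℕ, lurothMap^[k + 1] x
      = s (k + 1) * (lurothMap^[k] x - 1 / (lurothDigit (k + 1) x : ℝ)) := by
    intro k
    rw [Function.iterate_succ_apply']
    rfl
  have hpart : ∀ N : ℕ, ∑ k ∈ Finset.range N, 1 / ((∏ h ∈ Finset.Icc 1 k, s h) *
      (lurothDigit (k + 1) x : ℝ)) = x - lurothMap^[N] x / ∏ h ∈ Finset.Icc 1 N, s h := by
    intro N
    induction N with
    | zero => simp
    | succ k ih =>
      rw [Finset.sum_range_succ, ih, Finset.prod_Icc_succ_top (by omega), hstep]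
      have h1 := (hPpos k).ne'
      have h2 : s (k + 1) ≠ 0 := by have := hs2 (k + 1); linarith
      have h3 : (lurothDigit (k + 1) x : ℝ) ≠ 0 := by have := hd' (k + 1); linarith
      field_simp
      ring
  have hnn : ∀ k : ℕ, 0 ≤ 1 / ((∏ h ∈ Finset.Icc 1 k, s h) * (lurothDigit (k + 1) x : ℝ)) :=
    fun k => by have := hPpos k; positivity
  rw [hasSum_iff_tendsto_nat_of_nonneg hnn]
  have hlim : Tendsto (fun N : ℕ => lurothMap^[N] x / ∏ h ∈ Finset.Icc 1 N, s h) atTop (𝓝 0) := by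
    refine squeeze_zero (g := fun N : ℕ => (1 / 2 : ℝ) ^ N) (fun N => ?_) (fun N => ?_)
      (tendsto_pow_atTop_nhds_zero_of_lt_one (by norm_num) (by norm_num))
    · exact div_nonneg (lurothMap_iterate_mem hx N).1.le (hPpos N).le
    · rw [one_div, inv_pow, ← one_div]
      exact div_le_div₀ zero_le_one (lurothMap_iterate_mem hx N).2 (by positivity) (hP N)
  have := (tendsto_const_nhds (x := x)).sub hlim
  rw [sub_zero] at this
  exact this.congr fun N => (hpart N).symm

/-! ### Distribution functions on `[0,1]` and the two basic conditions -/

/-- `F` is (the extension to `ℝ` of) a distribution function on `[0,1]` with `F(0) = 0`. -/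
structure IsDistributionFunction01 (F : ℝ → ℝ) : Prop where
  mono : Monotone F
  right_cont : ∀ x, ContinuousWithinAt F (Set.Ici x) x
  eq_zero : ∀ x, x ≤ 0 → F x = 0
  eq_one : ∀ x, 1 ≤ x → F x = 1

/-- Condition (i): the `α_n` are positive, `0 < liminf α_n ≤ limsup α_n < ∞`, and
`F_n(t)/t → α_n` as `t → 0⁺`, uniformly in `n ≥ 1`. -/
structure ConditionI (F : ℕ → ℝ → ℝ) (α : ℕ → ℝ) : Prop where
  pos : ∀ n, 1 ≤ n → 0 < α n
  bounds : ∃ c C : ℝ, 0 < c ∧ ∀ᶠ n in atTop, c ≤ α n ∧ α n ≤ C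
  unif : TendstoUniformlyOn (fun (t : ℝ) (n : ℕ) => F n t / t) α (𝓝[>] 0) (Set.Ici 1)

/-- Condition (ii): `sup_{n ≥ 1} ∫_0^t (1/u) |F_n(u)/u - α_n| du → 0` as `t → 0⁺`. -/
def ConditionII (F : ℕ → ℝ → ℝ) (α : ℕ → ℝ) : Prop :=
  Tendsto (fun t : ℝ => ⨆ n ∈ Set.Ici (1 : ℕ),
    ∫⁻ u in Set.Ioo (0 : ℝ) t, ENNReal.ofReal (1 / u * |F n u / u - α n|)) (𝓝[>] 0) (𝓝 0)

/-- The distribution function of the uniform law on `(0,1)`. -/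
def uniformCDF (x : ℝ) : ℝ := max 0 (min x 1)

/-! ### Oppenheim expansions -/

/-- `δ_j(h,k,q) = φ_j(h) (1+q) / (k + φ_j(h) q)`. -/
def oppenheimDelta (φ : ℕ → ℕ → ℝ) (j h k : ℕ) (q : ℝ) : ℝ :=
  φ j h * (1 + q) / (k + φ j h * q)

/-- The Oppenheim scheme: the positive integer valued random variables `Θ_1, Θ_2, …` satisfy
`P(Θ_{n+1} = h_{n+1} | Θ_n = h_n, …, Θ_1 = h_1) = F_n(β_n) - F_n(α_n)` with
`α_n = δ_n(h_n, h_{n+1} + 1, q_n)`, `β_n = δ_n(h_n, h_{n+1}, q_n)`, `q_n = q_n(h_1, …, h_n)`,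
for all positive integers `h_j` with `h_j ≥ φ_{j-1}(h_{j-1})`, `2 ≤ j ≤ n` (whenever the
conditioning event has positive probability). -/
structure IsOppenheimScheme {Ω : Type*} [MeasurableSpace Ω] (P : Measure Ω) (F : ℕ → ℝ → ℝ)
    (φ : ℕ → ℕ → ℝ) (q : (n : ℕ) → (Fin n → ℕ) → ℝ) (Θ : ℕ → Ω → ℕ) : Prop where
  measurable : ∀ n, 1 ≤ n → Measurable (Θ n)
  pos : ∀ n, 1 ≤ n → ∀ᵐ ω ∂P, 1 ≤ Θ n ω
  φ_pos : ∀ n, 1 ≤ n → ∀ h, 1 ≤ h → 0 < φ n h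
  q_nonneg : ∀ n, 1 ≤ n → ∀ v, 0 ≤ q n v
  cond_law : ∀ n, 1 ≤ n → ∀ h : ℕ → ℕ, (∀ j, 1 ≤ j → 1 ≤ h j) →
    (∀ j, 2 ≤ j → j ≤ n → φ (j - 1) (h (j - 1)) ≤ (h j : ℝ)) →
    P {ω | ∀ j, 1 ≤ j → j ≤ n → Θ j ω = h j} ≠ 0 →
    (ProbabilityTheory.cond P {ω | ∀ j, 1 ≤ j → j ≤ n → Θ j ω = h j}).real
        {ω | Θ (n + 1) ω = h (n + 1)}
      = F n (oppenheimDelta φ n (h n) (h (n + 1)) (q n fun i => h (i + 1)))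
        - F n (oppenheimDelta φ n (h n) (h (n + 1) + 1) (q n fun i => h (i + 1)))

/-- `R_n = (Θ_{n+1} + φ_n(Θ_n) Q_n) / (φ_n(Θ_n) (1 + Q_n))` with `Q_n = q_n(Θ_1, …, Θ_n)`. -/
def oppenheimR {Ω : Type*} (φ : ℕ → ℕ → ℝ) (q : (n : ℕ) → (Fin n → ℕ) → ℝ) (Θ : ℕ → Ω → ℕ)
    (n : ℕ) (ω : Ω) : ℝ :=
  (Θ (n + 1) ω + φ n (Θ n ω) * q n (fun i => Θ (i + 1) ω)) /
    (φ n (Θ n ω) * (1 + q n (fun i => Θ (i + 1) ω)))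

/-- The Lüroth case of the Oppenheim scheme: `Θ_n = D_n - 1`, `φ_n ≡ 1`, `q_n ≡ 0`,
on `[0,1]` with Lebesgue measure. -/
def LurothScheme (F : ℕ → ℝ → ℝ) : Prop :=
  IsOppenheimScheme lebesgue01 F (fun _ _ => 1) (fun _ _ => 0) (fun n x => lurothDigit n x - 1)

/-! ### Assumptions on the weights -/

/-- The assumptions on the array `a k n = a_{k,n}` (`1 ≤ k ≤ n`) and on `ρ`, with limit `ℓ`. -/
structure WeightAssumptions (α : ℕ → ℝ) (a : ℕ → ℕ → ℝ) (ρ : ℕ → ℝ) (ℓ : ℝ) : Prop where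
  pos : ∀ n k, 1 ≤ k → k ≤ n → 0 < a k n
  norm_tendsto : Tendsto (fun n : ℕ => ρ n * Real.log n) atTop atTop
  limsup_finite : IsBoundedUnder (· ≤ ·) atTop (fun n : ℕ =>
    (∑ k ∈ Finset.Icc 1 n, α k * a k n * |Real.log (α k * a k n)|) / (ρ n * Real.log n))
  lim_eq : Tendsto (fun n : ℕ =>
    (∑ k ∈ Finset.Icc 1 n, α k * a k n * Real.log (α k * a k n)) / (ρ n * Real.log n))
    atTop (𝓝 (-ℓ))
  sum_bounded : BddAbove (Set.range fun n : ℕ => ∑ k ∈ Finset.Icc 1 n, α k * a k n)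

end

noncomputable section

/-! ### The digits are independent and identically distributed -/

/-! On the interval where the first digit is `d`, the Lüroth map is affine of slope `d (d - 1)` onto
`(0,1]`. Hence Lebesgue measure is invariant, the first digit is independent of the image point, and
the digits are i.i.d. with `P(D = d) = 1 / (d (d - 1))` (`lebesgue01_preimage_firstDigit_inter`,
`indepFun_lurothDigit`). The conditional laws are therefore explicit: they verify the scheme for the
uniform law, and for a general `F` they force `F_n(1/h) = 1/h`, so `α_n = 1`.

What remains is a weak law for i.i.d. variables of infinite mean. Put `b = ρ_n log n` and truncate
each `w_k D_{k+1}` at `b`, where `w_k = a_{k,n}` and `∑ w_k ≤ A`. Some term is cut with probability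
at most `2A/b`. The truncated sum has variance at most `2bA`, so Chebyshev at distance `bε/2` costs
`8A/(ε² b)`. Its mean is `log b ∑ w_k - ∑ w_k log w_k` up to `A`, and dividing by `b` leaves `ℓ` in
the limit. -/

theorem lebesgue01_eq : lebesgue01 = volume.restrict (Set.Ioc (0 : ℝ) 1) :=
  (Measure.restrict_congr_set Ioc_ae_eq_Icc).symm

instance : IsProbabilityMeasure lebesgue01 :=
  ⟨by simp [lebesgue01]⟩

theorem ae_mem_Ioc : ∀ᵐ x ∂lebesgue01, x ∈ Set.Ioc (0 : ℝ) 1 := by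
  rw [lebesgue01_eq]
  exact ae_restrict_mem measurableSet_Ioc

theorem measurable_lurothFirstDigit : Measurable lurothFirstDigit := by
  have h : Measurable fun x : ℝ => ⌊1 / x⌋₊ :=
    Nat.measurable_floor.comp (measurable_const.div measurable_id)
  exact (measurable_of_countable (fun n : ℕ => n + 1)).comp h

theorem measurable_lurothMap : Measurable lurothMap := by
  have h : Measurable fun x : ℝ => (lurothFirstDigit x : ℝ) :=
    (measurable_of_countable (fun n : ℕ => (n : ℝ))).comp measurable_lurothFirstDigit
  unfold lurothMap
  fun_prop

theorem measurable_lurothDigit (n : ℕ) : Measurable (lurothDigit n) :=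
  measurable_lurothFirstDigit.comp (measurable_lurothMap.iterate _)

theorem lurothFirstDigit_eq {x : ℝ} {d : ℕ} (hd : 2 ≤ d) (hl : 1 / (d : ℝ) < x)
    (hu : x ≤ 1 / ((d : ℝ) - 1)) : lurothFirstDigit x = d := by
  have hd' : (2 : ℝ) ≤ d := by exact_mod_cast hd
  have hx : 0 < x := lt_of_le_of_lt (by positivity) hl
  have h : ⌊1 / x⌋₊ = d - 1 := by
    rw [Nat.floor_eq_iff (by positivity), Nat.cast_sub (by omega)]
    push_cast
    rw [le_div_iff₀ (by linarith)] at hu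
    rw [div_lt_iff₀ (by linarith)] at hl
    rw [le_div_iff₀ hx, div_lt_iff₀ hx]
    constructor <;> linarith
  unfold lurothFirstDigit
  omega

theorem lebesgue01_firstDigit_inter {d : ℕ} (hd : 2 ≤ d) (B : Set ℝ) :
    lebesgue01 (lurothFirstDigit ⁻¹' {d} ∩ lurothMap ⁻¹' B)
      = ENNReal.ofReal (1 / ((d : ℝ) * (d - 1))) * lebesgue01 B := by
  have hd' : (2 : ℝ) ≤ d := by exact_mod_cast hd
  have hs : 0 < (d : ℝ) * (d - 1) := mul_pos (by linarith) (by linarith)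
  -- Within `(0,1]` the event is the preimage of `B ∩ (0,1]` under a translation followed by a
  -- dilation. Both act on the volume of arbitrary sets, so `B` need not be measurable.
  have hset : (lurothFirstDigit ⁻¹' {d} ∩ lurothMap ⁻¹' B) ∩ Set.Ioc 0 1
      = (fun x : ℝ => x + (-(1 / (d : ℝ)))) ⁻¹'
          ((fun x : ℝ => (d : ℝ) * (d - 1) * x) ⁻¹' (B ∩ Set.Ioc 0 1)) := by
    ext x
    simp only [Set.mem_inter_iff, Set.mem_preimage, Set.mem_singleton_iff]
    constructor
    · rintro ⟨⟨h1, h2⟩, h3⟩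
      have h4 := lurothMap_mem h3
      have h5 : lurothMap x = (d : ℝ) * (d - 1) * (x + -(1 / (d : ℝ))) := by
        rw [lurothMap, h1, sub_eq_add_neg x]
      rw [h5] at h2 h4
      exact ⟨h2, h4⟩
    · rintro ⟨h2, h3, h4⟩
      have h5 : 1 / (d : ℝ) < x := by
        have := (mul_pos_iff_of_pos_left hs).1 h3
        linarith
      have h6 : x ≤ 1 / ((d : ℝ) - 1) := by
        have h7 : (d : ℝ) * (d - 1) * (x + -(1 / (d : ℝ))) = d * (x * (d - 1)) - (d - 1) := by
          field_simp
          ring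
        rw [h7] at h4
        rw [le_div_iff₀ (by linarith)]
        by_contra! hc
        nlinarith
      have h7 := lurothFirstDigit_eq hd h5 h6
      refine ⟨⟨h7, ?_⟩, lt_of_le_of_lt (by positivity) h5, h6.trans ?_⟩
      · rwa [lurothMap, h7, sub_eq_add_neg x]
      · rw [div_le_one (by linarith)]
        linarith
  rw [lebesgue01_eq, Measure.restrict_apply' measurableSet_Ioc,
    Measure.restrict_apply' measurableSet_Ioc, hset, measure_preimage_add_right,
    Real.volume_preimage_mul_left hs.ne', abs_of_pos (inv_pos.2 hs), one_div]

theorem lebesgue01_firstDigit {d : ℕ} (hd : 2 ≤ d) :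
    lebesgue01 (lurothFirstDigit ⁻¹' {d}) = ENNReal.ofReal (1 / ((d : ℝ) * (d - 1))) := by
  simpa using lebesgue01_firstDigit_inter hd Set.univ

theorem lebesgue01_firstDigit_inter_eq_mul (d : ℕ) (B : Set ℝ) :
    lebesgue01 (lurothFirstDigit ⁻¹' {d} ∩ lurothMap ⁻¹' B)
      = lebesgue01 (lurothFirstDigit ⁻¹' {d}) * lebesgue01 B := by
  rcases le_or_gt 2 d with hd | hd
  · rw [lebesgue01_firstDigit_inter hd B, lebesgue01_firstDigit hd]
  · have h0 : lebesgue01 (lurothFirstDigit ⁻¹' {d}) = 0 := by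
      refine measure_mono_null ?_ (ae_iff.1 ae_mem_Ioc)
      intro x hx hx'
      have := (lurothFirstDigit_spec hx').1
      simp only [Set.mem_preimage, Set.mem_singleton_iff] at hx
      omega
    rw [h0, zero_mul]
    exact measure_mono_null Set.inter_subset_left h0

/-- Independence of the first digit and the image point, by summing over the digits in `s`. -/
theorem lebesgue01_preimage_firstDigit_inter (s : Set ℕ) {B : Set ℝ} (hB : MeasurableSet B) :
    lebesgue01 (lurothFirstDigit ⁻¹' s ∩ lurothMap ⁻¹' B)
      = lebesgue01 (lurothFirstDigit ⁻¹' s) * lebesgue01 B := by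
  have hm : ∀ d, MeasurableSet (lurothFirstDigit ⁻¹' {d}) := fun d =>
    measurable_lurothFirstDigit (measurableSet_singleton d)
  have hdisj : Set.PairwiseDisjoint s fun d => lurothFirstDigit ⁻¹' {d} := fun i _ j _ hij =>
    Disjoint.preimage _ (Set.disjoint_singleton.2 hij)
  have hs : lurothFirstDigit ⁻¹' s = ⋃ d ∈ s, lurothFirstDigit ⁻¹' {d} := by
    ext x; simp
  rw [hs, Set.iUnion₂_inter,
    measure_biUnion s.to_countable (hdisj.mono fun _ => Set.inter_subset_left)
      fun d _ => (hm d).inter (measurable_lurothMap hB),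
    measure_biUnion s.to_countable hdisj fun d _ => hm d, ← ENNReal.tsum_mul_right]
  exact tsum_congr fun d => lebesgue01_firstDigit_inter_eq_mul d B

theorem measurePreserving_lurothMap : MeasurePreserving lurothMap lebesgue01 lebesgue01 := by
  refine ⟨measurable_lurothMap, ?_⟩
  ext B hB
  rw [Measure.map_apply measurable_lurothMap hB]
  simpa using lebesgue01_preimage_firstDigit_inter Set.univ hB

theorem lebesgue01_lurothDigit_preimage (n : ℕ) (s : Set ℕ) :
    lebesgue01 (lurothDigit n ⁻¹' s) = lebesgue01 (lurothFirstDigit ⁻¹' s) :=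
  (measurePreserving_lurothMap.iterate (n - 1)).measure_preimage
    (measurable_lurothFirstDigit s.to_countable.measurableSet).nullMeasurableSet

/-- With `y = T^(i-1) x`, `D_i` is the first digit of `y` and `D_j` is digit `j - i` of `T y`;
invariance and one-step independence conclude. The bound `1 ≤ i` matters, since truncated
subtraction makes digit `0` equal to digit `1`. -/
theorem indepFun_lurothDigit {i j : ℕ} (hi : 1 ≤ i) (hij : i < j) :
    IndepFun (lurothDigit i) (lurothDigit j) lebesgue01 := by
  rw [indepFun_iff_measure_inter_preimage_eq_mul]
  intro s t _ _
  have ht : MeasurableSet (lurothDigit (j - i) ⁻¹' t) :=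
    measurable_lurothDigit _ t.to_countable.measurableSet
  have hset : lurothDigit i ⁻¹' s ∩ lurothDigit j ⁻¹' t
      = lurothMap^[i - 1] ⁻¹' (lurothFirstDigit ⁻¹' s ∩
          lurothMap ⁻¹' (lurothDigit (j - i) ⁻¹' t)) := by
    ext x
    have h : lurothMap^[j - 1] x = lurothMap^[j - i - 1] (lurothMap (lurothMap^[i - 1] x)) := by
      rw [← Function.iterate_succ_apply, ← Function.iterate_add_apply]
      congr 2
      omega
    simp only [Set.mem_inter_iff, Set.mem_preimage, lurothDigit, h]
  rw [hset, (measurePreserving_lurothMap.iterate (i - 1)).measure_preimage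
      ((measurable_lurothFirstDigit s.to_countable.measurableSet).inter
        (measurable_lurothMap ht)).nullMeasurableSet,
    lebesgue01_preimage_firstDigit_inter s ht, lebesgue01_lurothDigit_preimage,
    lebesgue01_lurothDigit_preimage, lebesgue01_lurothDigit_preimage]

/-- The cylinder of points with first `n` digits `h 1, …, h n`. -/
def lurothCylinder (n : ℕ) (h : ℕ → ℕ) : Set ℝ := {x | ∀ j, 1 ≤ j → j ≤ n → lurothDigit j x = h j}

theorem lurothCylinder_succ (n : ℕ) (h : ℕ → ℕ) :
    lurothCylinder (n + 1) h = lurothCylinder n h ∩ lurothDigit (n + 1) ⁻¹' {h (n + 1)} := by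
  ext x
  simp only [lurothCylinder, Set.mem_ofPred_eq, Set.mem_inter_iff, Set.mem_preimage,
    Set.mem_singleton_iff]
  constructor
  · exact fun H => ⟨fun j h1 h2 => H j h1 (by omega), H _ (by omega) le_rfl⟩
  · rintro ⟨H1, H2⟩ j h1 h2
    rcases Nat.lt_or_ge n j with hj | hj
    · obtain rfl : j = n + 1 := by omega
      exact H2
    · exact H1 j h1 hj

/-- The past is independent of the future orbit. The induction varies `B`: the step applies the
hypothesis to `{first digit = h (n + 1)} ∩ T⁻¹ B`. -/
theorem lebesgue01_cylinder_inter (n : ℕ) (h : ℕ → ℕ) {B : Set ℝ} (hB : MeasurableSet B) :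
    lebesgue01 (lurothCylinder n h ∩ lurothMap^[n] ⁻¹' B)
      = lebesgue01 (lurothCylinder n h) * lebesgue01 B := by
  induction n generalizing B with
  | zero =>
    have : lurothCylinder 0 h = Set.univ := by
      ext x
      simp only [lurothCylinder, Set.mem_ofPred_eq, Set.mem_univ, iff_true]
      omega
    simp [this]
  | succ n ih =>
    have key : ∀ {B : Set ℝ}, MeasurableSet B →
        lebesgue01 (lurothCylinder (n + 1) h ∩ lurothMap^[n + 1] ⁻¹' B) =
          lebesgue01 (lurothCylinder n h) *
            (lebesgue01 (lurothFirstDigit ⁻¹' {h (n + 1)}) * lebesgue01 B) := by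
      intro B hB
      rw [← lebesgue01_preimage_firstDigit_inter _ hB, ← ih
        ((measurable_lurothFirstDigit (measurableSet_singleton _)).inter
          (measurable_lurothMap hB)), lurothCylinder_succ, Set.inter_assoc]
      congr 2
      ext x
      simp only [Set.mem_inter_iff, Set.mem_preimage, Function.iterate_succ_apply']
      rfl
    have h1 := key MeasurableSet.univ
    simp only [Set.preimage_univ, Set.inter_univ, measure_univ, mul_one] at h1
    rw [key hB, h1, mul_assoc]

theorem lebesgue01_cylinder_succ (n : ℕ) (h : ℕ → ℕ) :
    lebesgue01 (lurothCylinder (n + 1) h) =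
      lebesgue01 (lurothCylinder n h) * lebesgue01 (lurothFirstDigit ⁻¹' {h (n + 1)}) := by
  rw [lurothCylinder_succ]
  exact lebesgue01_cylinder_inter n h (measurable_lurothFirstDigit (measurableSet_singleton _))

theorem lebesgue01_cylinder_ne_zero (n : ℕ) {h : ℕ → ℕ} (hh : ∀ j, 1 ≤ j → 2 ≤ h j) :
    lebesgue01 (lurothCylinder n h) ≠ 0 := by
  induction n with
  | zero =>
    have : lurothCylinder 0 h = Set.univ := by
      ext x
      simp only [lurothCylinder, Set.mem_ofPred_eq, Set.mem_univ, iff_true]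
      omega
    simp [this]
  | succ n ih =>
    rw [lebesgue01_cylinder_succ, lebesgue01_firstDigit (hh _ (by omega))]
    have : (2 : ℝ) ≤ h (n + 1) := by exact_mod_cast hh (n + 1) (by omega)
    refine mul_ne_zero ih (ENNReal.ofReal_pos.2 ?_).ne'
    exact one_div_pos.2 (mul_pos (by linarith) (by linarith))

/-! ### The Oppenheim scheme of the Lüroth digits -/

theorem uniformCDF_of_mem {x : ℝ} (h0 : 0 ≤ x) (h1 : x ≤ 1) : uniformCDF x = x := by
  rw [uniformCDF, min_eq_left h1, max_eq_right h0]

theorem isDistributionFunction01_uniformCDF : IsDistributionFunction01 uniformCDF where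
  mono := fun x y h => max_le_max le_rfl (min_le_min h le_rfl)
  right_cont := fun x => by
    have : Continuous uniformCDF := by unfold uniformCDF; fun_prop
    exact this.continuousWithinAt
  eq_zero := fun x hx => by
    rw [uniformCDF, min_eq_left (by linarith), max_eq_left hx]
  eq_one := fun x hx => by
    rw [uniformCDF, min_eq_right hx, max_eq_right zero_le_one]

theorem conditionI_uniformCDF : ConditionI (fun _ => uniformCDF) (fun _ => 1) where
  pos := fun _ _ => one_pos
  bounds := ⟨1, 1, one_pos, Eventually.of_forall fun _ => ⟨le_rfl, le_rfl⟩⟩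
  unif := by
    intro u hu
    filter_upwards [Ioo_mem_nhdsGT (zero_lt_one' ℝ)] with t ht n _
    rw [uniformCDF_of_mem ht.1.le ht.2.le, div_self ht.1.ne']
    exact refl_mem_uniformity hu

theorem conditionII_uniformCDF : ConditionII (fun _ => uniformCDF) (fun _ => 1) := by
  refine tendsto_const_nhds.congr' ?_
  filter_upwards [Ioo_mem_nhdsGT (zero_lt_one' ℝ)] with t ht
  symm
  simp only [ENNReal.iSup_eq_zero]
  intro _ _
  rw [← lintegral_zero (μ := volume.restrict (Set.Ioo 0 t))]
  refine setLIntegral_congr_fun measurableSet_Ioo fun u hu => ?_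
  simp only [uniformCDF_of_mem hu.1.le (hu.2.trans ht.2).le, div_self hu.1.ne', sub_self, abs_zero,
    mul_zero, ENNReal.ofReal_zero]

theorem oppenheimDelta_one_zero (j h k : ℕ) :
    oppenheimDelta (fun _ _ => 1) j h k 0 = 1 / (k : ℝ) := by
  simp [oppenheimDelta]

theorem setOf_lurothDigit_sub_one_eq (n : ℕ) {h : ℕ → ℕ} (hh : ∀ j, 1 ≤ j → 1 ≤ h j) :
    {x | ∀ j, 1 ≤ j → j ≤ n → lurothDigit j x - 1 = h j}
      = lurothCylinder n fun j => h j + 1 := by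
  ext x
  simp only [Set.mem_ofPred_eq, lurothCylinder]
  refine forall₃_congr fun j h1 _ => ?_
  have := hh j h1
  omega

/-- By independence the history cancels, leaving the one-digit law at `d = h (n + 1) + 1`. -/
theorem cond_lurothDigit (n : ℕ) {h : ℕ → ℕ} (hh : ∀ j, 1 ≤ j → 1 ≤ h j) :
    (ProbabilityTheory.cond lebesgue01
        {x | ∀ j, 1 ≤ j → j ≤ n → lurothDigit j x - 1 = h j}).real
          {x | lurothDigit (n + 1) x - 1 = h (n + 1)}
      = 1 / (h (n + 1) : ℝ) - 1 / ((h (n + 1) : ℝ) + 1) := by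
  have h1 := hh (n + 1) (by omega)
  have h1' : (1 : ℝ) ≤ h (n + 1) := by exact_mod_cast h1
  have hset : {x | lurothDigit (n + 1) x - 1 = h (n + 1)}
      = lurothDigit (n + 1) ⁻¹' {h (n + 1) + 1} := by
    ext x
    simp only [Set.mem_ofPred_eq, Set.mem_preimage, Set.mem_singleton_iff]
    omega
  have hms : MeasurableSet (lurothCylinder n fun j => h j + 1) := by
    have : lurothCylinder n (fun j => h j + 1)
        = ⋂ j, ⋂ (_ : 1 ≤ j), ⋂ (_ : j ≤ n), lurothDigit j ⁻¹' {h j + 1} := by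
      ext x
      simp [lurothCylinder]
    rw [this]
    exact MeasurableSet.iInter fun j => MeasurableSet.iInter fun _ => MeasurableSet.iInter fun _ =>
      measurable_lurothDigit j (measurableSet_singleton _)
  have hne := lebesgue01_cylinder_ne_zero n (h := fun j => h j + 1)
    fun j hj => by have := hh j hj; omega
  rw [setOf_lurothDigit_sub_one_eq n hh, hset, Measure.real, ProbabilityTheory.cond_apply hms,
    ← lurothCylinder_succ n fun j => h j + 1, lebesgue01_cylinder_succ, ← mul_assoc,
    ENNReal.inv_mul_cancel hne (measure_ne_top _ _), one_mul,
    lebesgue01_firstDigit (by omega), ENNReal.toReal_ofReal]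
  · have : (h (n + 1) : ℝ) ≠ 0 := by linarith
    push_cast
    rw [add_sub_cancel_right]
    field_simp
    ring
  · push_cast
    rw [add_sub_cancel_right]
    positivity

theorem lurothScheme_uniformCDF : LurothScheme fun _ => uniformCDF where
  measurable := fun n _ =>
    (measurable_of_countable (fun k : ℕ => k - 1)).comp (measurable_lurothDigit n)
  pos := fun n _ => by
    filter_upwards [ae_mem_Ioc] with x hx
    have := (lurothDigit_expansion hx).1 n
    omega
  φ_pos := fun _ _ _ _ => one_pos
  q_nonneg := fun _ _ _ => le_rfl
  cond_law := fun n _ h hh _ _ => by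
    have h1 : (1 : ℝ) ≤ h (n + 1) := by exact_mod_cast hh (n + 1) (by omega)
    rw [cond_lurothDigit n hh, oppenheimDelta_one_zero, oppenheimDelta_one_zero,
      uniformCDF_of_mem (by positivity) ((div_le_one (by linarith)).2 h1),
      uniformCDF_of_mem (by positivity)
        ((div_le_one (by positivity)).2 (by push_cast; linarith))]
    push_cast
    rfl

/-- The law of the digits forces `F_n(1/h) = 1/h` for every positive integer `h`. -/
theorem LurothScheme.apply_one_div {F : ℕ → ℝ → ℝ} (hF : LurothScheme F) {n : ℕ} (hn : 1 ≤ n)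
    (hFn : IsDistributionFunction01 (F n)) (k : ℕ) :
    F n (1 / ((k : ℝ) + 1)) = 1 / ((k : ℝ) + 1) := by
  induction k with
  | zero => simpa using hFn.eq_one 1 le_rfl
  | succ k ih =>
    -- Any history of positive probability serves, so the past is taken constantly `1`. The scheme
    -- then gives the increment of `F n` from `1/(k+2)` to `1/(k+1)`, which telescopes down from `F
    -- n 1 = 1`.
    set h : ℕ → ℕ := fun j => if j = n + 1 then k + 1 else 1 with hdef
    have hh : ∀ j, 1 ≤ j → 1 ≤ h j := fun j _ => by
      simp only [hdef]; split_ifs <;> omega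
    have hk : h (n + 1) = k + 1 := by simp [hdef]
    have hne := lebesgue01_cylinder_ne_zero n (h := fun j => h j + 1)
      fun j hj => by have := hh j hj; omega
    rw [← setOf_lurothDigit_sub_one_eq n hh] at hne
    have h1 := hF.cond_law n hn h hh (fun j hj _ => by exact_mod_cast hh j (by omega)) hne
    rw [cond_lurothDigit n hh, oppenheimDelta_one_zero, oppenheimDelta_one_zero, hk] at h1
    push_cast at h1 ⊢
    linarith

/-- Along `t = 1/(k+1)` the ratio `F n t / t` is identically `1`, so its limit `α n` is `1`. -/
theorem LurothScheme.alpha_eq_one {F : ℕ → ℝ → ℝ} {α : ℕ → ℝ} (hF : LurothScheme F)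
    (hα : ConditionI F α) {n : ℕ} (hn : 1 ≤ n) (hFn : IsDistributionFunction01 (F n)) :
    α n = 1 := by
  have h1 : Tendsto (fun k : ℕ => 1 / ((k : ℝ) + 1)) atTop (𝓝[>] 0) :=
    tendsto_nhdsWithin_iff.2 ⟨tendsto_one_div_add_atTop_nhds_zero_nat,
      Eventually.of_forall fun k => Set.mem_Ioi.2 (by positivity)⟩
  have h2 := (hα.unif.tendsto_at (Set.mem_Ici.2 hn)).comp h1
  refine tendsto_nhds_unique h2 (tendsto_const_nhds.congr fun k => ?_)
  simp only [Function.comp]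
  rw [hF.apply_one_div hn hFn k, div_self (by positivity)]

/-! ### Truncated moments of the digits -/

theorem lebesgue01_real_lurothDigit {d : ℕ} (hd : 2 ≤ d) (n : ℕ) :
    lebesgue01.real (lurothDigit n ⁻¹' {d}) = 1 / ((d : ℝ) * (d - 1)) := by
  have hd' : (2 : ℝ) ≤ d := by exact_mod_cast hd
  rw [Measure.real, lebesgue01_lurothDigit_preimage, lebesgue01_firstDigit hd,
    ENNReal.toReal_ofReal]
  exact (one_div_pos.2 (mul_pos (by linarith) (by linarith))).le

/-- Vanishing beyond `N` makes the integrand a.e. a finite sum of indicators, so no summability is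
at stake. -/
theorem integral_comp_lurothDigit (n : ℕ) {f : ℕ → ℝ} {N : ℕ} (hf : ∀ d, N < d → f d = 0) :
    ∫ x, f (lurothDigit n x) ∂lebesgue01
      = ∑ d ∈ Finset.Icc 2 N, f d / ((d : ℝ) * (d - 1)) := by
  have hm : ∀ d, MeasurableSet (lurothDigit n ⁻¹' {d}) := fun d =>
    measurable_lurothDigit n (measurableSet_singleton d)
  have hae : (fun x => f (lurothDigit n x)) =ᵐ[lebesgue01]
      fun x => ∑ d ∈ Finset.Icc 2 N, (lurothDigit n ⁻¹' {d}).indicator (fun _ => f d) x := by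
    filter_upwards [ae_mem_Ioc] with x hx
    have h2 := (lurothDigit_expansion hx).1 n
    have h : ∀ d, (lurothDigit n ⁻¹' {d}).indicator (fun _ => f d) x
        = if lurothDigit n x = d then f d else 0 := fun d => by
      classical simp [Set.indicator_apply]
    rw [Finset.sum_congr rfl fun d _ => h d, Finset.sum_ite_eq]
    split_ifs with h3
    · rfl
    · rw [Finset.mem_Icc] at h3
      exact hf _ (by omega)
  rw [integral_congr_ae hae, integral_finsetSum _ fun d _ =>
    (integrable_const (f d)).indicator (hm d)]
  refine Finset.sum_congr rfl fun d hd => ?_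
  rw [integral_indicator_const _ (hm d), lebesgue01_real_lurothDigit (Finset.mem_Icc.1 hd).1,
    smul_eq_mul]
  ring

/-- The digit `d`, replaced by `0` if it exceeds `M`. -/
def truncDigit (M : ℝ) (d : ℕ) : ℝ := if (d : ℝ) ≤ M then d else 0

theorem truncDigit_nonneg (M : ℝ) (d : ℕ) : 0 ≤ truncDigit M d := by
  unfold truncDigit; split_ifs <;> simp

theorem truncDigit_le {M : ℝ} (hM : 0 ≤ M) (d : ℕ) : truncDigit M d ≤ M := by
  unfold truncDigit; split_ifs with h <;> assumption

theorem truncDigit_eq_zero {M : ℝ} {d : ℕ} (hd : ⌊M⌋₊ < d) : truncDigit M d = 0 :=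
  if_neg (not_le.2 (Nat.lt_of_floor_lt hd))

theorem truncDigit_eq_self {M : ℝ} (hM : 0 ≤ M) {d : ℕ} (hd : d ≤ ⌊M⌋₊) : truncDigit M d = d :=
  if_pos ((Nat.le_floor_iff hM).1 hd)

/-- Each term is `d / (d - 1) ≤ 2`, and there are at most `M` of them. -/
theorem integral_truncDigit_sq_le {M : ℝ} (hM : 0 ≤ M) (n : ℕ) :
    ∫ x, truncDigit M (lurothDigit n x) ^ 2 ∂lebesgue01 ≤ 2 * M := by
  rw [integral_comp_lurothDigit n (f := fun d => truncDigit M d ^ 2) (N := ⌊M⌋₊)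
    fun d hd => by simp [truncDigit_eq_zero hd]]
  calc ∑ d ∈ Finset.Icc 2 ⌊M⌋₊, truncDigit M d ^ 2 / ((d : ℝ) * (d - 1))
      ≤ ∑ d ∈ Finset.Icc 2 ⌊M⌋₊, (2 : ℝ) := Finset.sum_le_sum fun d hd => by
        have hd' := Finset.mem_Icc.1 hd
        have h2 : (2 : ℝ) ≤ d := by exact_mod_cast hd'.1
        rw [truncDigit_eq_self hM hd'.2, div_le_iff₀ (mul_pos (by linarith) (by linarith))]
        nlinarith
    _ = (⌊M⌋₊ + 1 - 2 : ℕ) * 2 := by simp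
    _ ≤ (⌊M⌋₊ : ℝ) * 2 := by gcongr; omega
    _ ≤ 2 * M := by linarith [Nat.floor_le hM]

/-- The truncated mean is `∑ 1 / (d - 1)`, the harmonic number of index `⌊M⌋₊ - 1`. -/
theorem abs_integral_truncDigit_sub_log_le {M : ℝ} (hM : 1 ≤ M) (n : ℕ) :
    |∫ x, truncDigit M (lurothDigit n x) ∂lebesgue01 - Real.log M| ≤ 1 := by
  have hM0 : 0 ≤ M := by linarith
  obtain ⟨N, hN⟩ : ∃ N, ⌊M⌋₊ = N + 1 :=
    Nat.exists_eq_succ_of_ne_zero (Nat.one_le_iff_ne_zero.1 ((Nat.one_le_floor_iff M).2 hM))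
  have hint : ∫ x, truncDigit M (lurothDigit n x) ∂lebesgue01 = (harmonic N : ℝ) := by
    rw [integral_comp_lurothDigit n (f := truncDigit M) (N := ⌊M⌋₊)
      fun d hd => truncDigit_eq_zero hd, harmonic_eq_sum_Icc]
    push_cast
    rw [hN, ← Finset.map_add_right_Icc 1 N 1, Finset.sum_map]
    refine Finset.sum_congr rfl fun d hd => ?_
    have hd' := Finset.mem_Icc.1 hd
    have h1 : (1 : ℝ) ≤ d := by exact_mod_cast hd'.1
    simp only [addRightEmbedding_apply]
    rw [truncDigit_eq_self hM0 (by omega)]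
    have h0 : (d : ℝ) ≠ 0 := by linarith
    push_cast
    rw [add_sub_cancel_right]
    field_simp
  have hfl : (N : ℝ) + 1 ≤ M := by
    have := Nat.floor_le hM0
    rw [hN] at this
    exact_mod_cast this
  have hlt : M < (N : ℝ) + 1 + 1 := by
    have := Nat.lt_floor_add_one M
    rw [hN] at this
    exact_mod_cast this
  have hN0 : (0 : ℝ) ≤ N := Nat.cast_nonneg N
  have hlow := log_add_one_le_harmonic N
  have hup := harmonic_le_one_add_log N
  push_cast at hlow
  rw [hint, abs_le]
  constructor
  -- Here `M < N + 2 ≤ 2 (N + 1)`, and `log 2 ≤ 1` absorbs the factor.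
  · have h1 : Real.log M ≤ Real.log 2 + Real.log ((N : ℝ) + 1) := by
      rw [← Real.log_mul (by norm_num) (by positivity)]
      exact Real.log_le_log (by linarith) (by linarith)
    have h2 : Real.log 2 ≤ 1 := by linarith [Real.log_two_lt_d9]
    linarith
  · have h1 : Real.log N ≤ Real.log M := by
      -- `N = 0` occurs for `M < 2`; there `Real.log 0 = 0` is the default value.
      rcases hN0.eq_or_lt with h0 | h0
      · rw [← h0, Real.log_zero]
        exact Real.log_nonneg hM
      · exact Real.log_le_log h0 (by linarith)
    linarith

/-- If `D > M` then `x ≤ 1/(D - 1) ≤ 2/D < 2/M`, using `D ≥ 2`. -/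
theorem lebesgue01_lt_lurothDigit_le {M : ℝ} (hM : 0 < M) (n : ℕ) :
    lebesgue01 {x | M < lurothDigit n x} ≤ ENNReal.ofReal (2 / M) := by
  have h1 : lebesgue01 {x | M < lurothDigit n x}
      = lebesgue01 (lurothFirstDigit ⁻¹' {d | M < d}) :=
    lebesgue01_lurothDigit_preimage n {d | M < d}
  have h2 : lurothFirstDigit ⁻¹' {d | M < d} ∩ Set.Ioc 0 1 ⊆ Set.Ioc 0 (2 / M) := by
    rintro x ⟨hx, hx'⟩
    obtain ⟨hd, -, hu⟩ := lurothFirstDigit_spec hx'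
    have hd' : (2 : ℝ) ≤ lurothFirstDigit x := by exact_mod_cast hd
    have hx2 : M < (lurothFirstDigit x : ℝ) := hx
    refine ⟨hx'.1, hu.trans ?_⟩
    rw [div_le_div_iff₀ (by linarith) hM]
    linarith
  rw [h1, lebesgue01_eq, Measure.restrict_apply' measurableSet_Ioc]
  refine (measure_mono h2).trans ?_
  simp

/-! ### The weak law -/

/-- The weighted digit `w_k D_{k+1}`, replaced by `0` if it exceeds `b`. -/
def truncTerm (w : ℕ → ℝ) (b : ℝ) (k : ℕ) (x : ℝ) : ℝ :=
  w k * truncDigit (b / w k) (lurothDigit (k + 1) x)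

section

variable {n : ℕ} {w : ℕ → ℝ} {b : ℝ}

theorem measurable_truncTerm (w : ℕ → ℝ) (b : ℝ) (k : ℕ) : Measurable (truncTerm w b k) :=
  (measurable_of_countable fun d : ℕ => w k * truncDigit (b / w k) d).comp
    (measurable_lurothDigit (k + 1))

theorem memLp_truncTerm {k : ℕ} (hw : 0 < w k) (hb : 0 < b) :
    MemLp (truncTerm w b k) 2 lebesgue01 := by
  refine MemLp.of_bound (measurable_truncTerm w b k).aestronglyMeasurable b
    (Eventually.of_forall fun x => ?_)
  rw [truncTerm, Real.norm_of_nonneg (mul_nonneg hw.le (truncDigit_nonneg _ _))]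
  calc w k * truncDigit (b / w k) (lurothDigit (k + 1) x) ≤ w k * (b / w k) := by
        gcongr
        exact truncDigit_le (by positivity) _
    _ = b := by field_simp

/-- Truncating at `b / w k` turns `w²` times the second moment into a bound linear in `w k`, so
bounded `∑ w_k` controls the total variance. -/
theorem variance_truncTerm_le {k : ℕ} (hw : 0 < w k) (hb : 0 < b) :
    variance (truncTerm w b k) lebesgue01 ≤ 2 * b * w k := by
  refine (variance_le_expectation_sq (measurable_truncTerm w b k).aestronglyMeasurable).trans ?_
  have h : (truncTerm w b k ^ 2 : ℝ → ℝ)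
      = fun x => w k ^ 2 * truncDigit (b / w k) (lurothDigit (k + 1) x) ^ 2 := by
    ext x
    simp [truncTerm, mul_pow]
  rw [h, integral_const_mul]
  calc w k ^ 2 * ∫ x, truncDigit (b / w k) (lurothDigit (k + 1) x) ^ 2 ∂lebesgue01
      ≤ w k ^ 2 * (2 * (b / w k)) := by
        gcongr
        exact integral_truncDigit_sq_le (by positivity) _
    _ = 2 * b * w k := by field_simp

theorem variance_sum_truncTerm_le (hw : ∀ k ∈ Finset.Icc 1 n, 0 < w k) (hb : 0 < b) :
    variance (∑ k ∈ Finset.Icc 1 n, truncTerm w b k) lebesgue01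
      ≤ 2 * b * ∑ k ∈ Finset.Icc 1 n, w k := by
  have hind : ∀ i j, i < j → IndepFun (truncTerm w b i) (truncTerm w b j) lebesgue01 :=
    fun i j hij => (indepFun_lurothDigit (by omega) (Nat.succ_lt_succ hij)).comp
      (measurable_of_countable fun d : ℕ => w i * truncDigit (b / w i) d)
      (measurable_of_countable fun d : ℕ => w j * truncDigit (b / w j) d)
  rw [IndepFun.variance_sum (fun k hk => memLp_truncTerm (hw k hk) hb), Finset.mul_sum]
  · exact Finset.sum_le_sum fun k hk => variance_truncTerm_le (hw k hk) hb
  · intro i _ j _ hij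
    rcases lt_or_gt_of_ne hij with h | h
    · exact hind i j h
    · exact (hind j i h).symm

/-- Termwise `log (b / w) = log b - log w`; the condition `w k ≤ b` makes the truncation level `b /
w k` at least `1`. -/
theorem abs_integral_sum_truncTerm_sub_le (hw : ∀ k ∈ Finset.Icc 1 n, 0 < w k)
    (hwb : ∀ k ∈ Finset.Icc 1 n, w k ≤ b) (hb : 0 < b) :
    |∫ x, (∑ k ∈ Finset.Icc 1 n, truncTerm w b k) x ∂lebesgue01
        - (Real.log b * ∑ k ∈ Finset.Icc 1 n, w k
            - ∑ k ∈ Finset.Icc 1 n, w k * Real.log (w k))|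
      ≤ ∑ k ∈ Finset.Icc 1 n, w k := by
  simp only [Finset.sum_apply]
  rw [integral_finsetSum _ fun k hk => (memLp_truncTerm (hw k hk) hb).integrable one_le_two,
    Finset.mul_sum, ← Finset.sum_sub_distrib, ← Finset.sum_sub_distrib]
  refine (Finset.abs_sum_le_sum_abs _ _).trans (Finset.sum_le_sum fun k hk => ?_)
  have hk0 := hw k hk
  have h := abs_integral_truncDigit_sub_log_le ((one_le_div hk0).2 (hwb k hk)) (k + 1)
  rw [Real.log_div hb.ne' hk0.ne'] at h
  unfold truncTerm
  rw [integral_const_mul]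
  calc _ = |w k * (∫ x, truncDigit (b / w k) (lurothDigit (k + 1) x) ∂lebesgue01
          - (Real.log b - Real.log (w k)))| := by
        congr 1
        ring
    _ ≤ w k * 1 := by
        rw [abs_mul, abs_of_pos hk0]
        gcongr
    _ = w k := mul_one _

theorem lebesgue01_exists_lt_lurothDigit_le (hw : ∀ k ∈ Finset.Icc 1 n, 0 < w k) (hb : 0 < b) :
    lebesgue01 {x | ∃ k ∈ Finset.Icc 1 n, b / w k < lurothDigit (k + 1) x}
      ≤ ENNReal.ofReal (2 * (∑ k ∈ Finset.Icc 1 n, w k) / b) := by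
  have hset : {x | ∃ k ∈ Finset.Icc 1 n, b / w k < lurothDigit (k + 1) x}
      = ⋃ k ∈ Finset.Icc 1 n, {x | b / w k < lurothDigit (k + 1) x} := by
    ext x
    simp only [Set.mem_ofPred_eq, Set.mem_iUnion, exists_prop]
  rw [hset]
  refine (measure_biUnion_finset_le _ _).trans ?_
  rw [Finset.mul_sum, Finset.sum_div,
    ENNReal.ofReal_sum_of_nonneg fun k hk => by have := hw k hk; positivity]
  refine Finset.sum_le_sum fun k hk => ?_
  have hk0 := hw k hk
  refine (lebesgue01_lt_lurothDigit_le (div_pos hb hk0) (k + 1)).trans (le_of_eq ?_)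
  rw [div_div_eq_mul_div]

/-- Chebyshev's inequality for the truncated sum, together with the bound for the truncation. -/
theorem lebesgue01_abs_sum_sub_ge_le (hw : ∀ k ∈ Finset.Icc 1 n, 0 < w k) (hb : 0 < b)
    {ε m : ℝ} (hε : 0 < ε)
    (hm : |∫ x, (∑ k ∈ Finset.Icc 1 n, truncTerm w b k) x ∂lebesgue01 - m| ≤ b * (ε / 2)) :
    lebesgue01 {x | b * ε ≤ |∑ k ∈ Finset.Icc 1 n, w k * (lurothDigit (k + 1) x : ℝ) - m|}
      ≤ ENNReal.ofReal (2 * (∑ k ∈ Finset.Icc 1 n, w k) / b)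
        + ENNReal.ofReal (2 * b * (∑ k ∈ Finset.Icc 1 n, w k) / (b * (ε / 2)) ^ 2) := by
  set Y := ∑ k ∈ Finset.Icc 1 n, truncTerm w b k with hY
  have hsub : {x | b * ε ≤ |∑ k ∈ Finset.Icc 1 n, w k * (lurothDigit (k + 1) x : ℝ) - m|}
      ⊆ {x | ∃ k ∈ Finset.Icc 1 n, b / w k < lurothDigit (k + 1) x}
        ∪ {x | b * (ε / 2) ≤ |Y x - ∫ x, Y x ∂lebesgue01|} := by
    intro x hx
    -- If no term is cut, the sum equals `Y x`. Half of `ε` then goes to the bias `hm` and half to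
    -- the fluctuation of `Y`.
    by_cases hc : ∃ k ∈ Finset.Icc 1 n, b / w k < lurothDigit (k + 1) x
    · exact Or.inl hc
    · right
      push Not at hc
      have hYx : ∑ k ∈ Finset.Icc 1 n, w k * (lurothDigit (k + 1) x : ℝ) = Y x := by
        rw [hY, Finset.sum_apply]
        refine Finset.sum_congr rfl fun k hk => ?_
        rw [truncTerm, truncDigit, if_pos (hc k hk)]
      simp only [Set.mem_ofPred_eq, hYx] at hx ⊢
      have := abs_sub_le (Y x) (∫ x, Y x ∂lebesgue01) m
      linarith
  refine (measure_mono hsub).trans ((measure_union_le _ _).trans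
    (add_le_add (lebesgue01_exists_lt_lurothDigit_le hw hb) ?_))
  have hL : MemLp Y 2 lebesgue01 :=
    memLp_finsetSum' _ fun k hk => memLp_truncTerm (hw k hk) hb
  refine (meas_ge_le_variance_div_sq hL (by positivity)).trans (ENNReal.ofReal_le_ofReal ?_)
  gcongr
  exact variance_sum_truncTerm_le hw hb

end

/-- The weak law for the independent Lüroth digits. -/
theorem tendstoInMeasure_sum_lurothDigit {a : ℕ → ℕ → ℝ} {b : ℕ → ℝ} {ℓ : ℝ}
    (hpos : ∀ n k, 1 ≤ k → k ≤ n → 0 < a k n) (hb : Tendsto b atTop atTop)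
    (hlim : Tendsto (fun n => (∑ k ∈ Finset.Icc 1 n, a k n * Real.log (a k n)) / b n) atTop
      (𝓝 (-ℓ)))
    (hbdd : BddAbove (Set.range fun n : ℕ => ∑ k ∈ Finset.Icc 1 n, a k n)) :
    TendstoInMeasure lebesgue01
      (fun n x => 1 / b n * ∑ k ∈ Finset.Icc 1 n, a k n * (lurothDigit (k + 1) x : ℝ))
      atTop (fun _ => ℓ) := by
  obtain ⟨A, hA⟩ := hbdd
  have hA' : ∀ n, ∑ k ∈ Finset.Icc 1 n, a k n ≤ A := fun n => hA ⟨n, rfl⟩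
  have hw : ∀ n, ∀ k ∈ Finset.Icc 1 n, 0 < a k n := fun n k hk =>
    hpos n k (Finset.mem_Icc.1 hk).1 (Finset.mem_Icc.1 hk).2
  have hs0 : ∀ n, 0 ≤ ∑ k ∈ Finset.Icc 1 n, a k n := fun n =>
    Finset.sum_nonneg fun k hk => (hw n k hk).le
  have hinv : Tendsto (fun n => (b n)⁻¹) atTop (𝓝 0) := tendsto_inv_atTop_zero.comp hb
  have hlog : Tendsto (fun n => Real.log (b n) / b n) atTop (𝓝 0) :=
    Real.isLittleO_log_id_atTop.tendsto_div_nhds_zero.comp hb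
  -- the means of the truncated sums
  have hmean : Tendsto (fun n => A * (b n)⁻¹ + A * (Real.log (b n) / b n)
      + |(∑ k ∈ Finset.Icc 1 n, a k n * Real.log (a k n)) / b n + ℓ|) atTop (𝓝 0) := by
    have h1 := (hlim.add_const ℓ).abs
    rw [neg_add_cancel, abs_zero] at h1
    simpa using ((hinv.const_mul A).add (hlog.const_mul A)).add h1
  rw [tendstoInMeasure_iff_norm]
  intro ε hε
  have hbound : Tendsto (fun n => ENNReal.ofReal (2 * A * (b n)⁻¹)
      + ENNReal.ofReal (8 * A / ε ^ 2 * (b n)⁻¹)) atTop (𝓝 0) := by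
    simpa using (ENNReal.tendsto_ofReal (hinv.const_mul (2 * A))).add
      (ENNReal.tendsto_ofReal (hinv.const_mul (8 * A / ε ^ 2)))
  refine tendsto_of_tendsto_of_tendsto_of_le_of_le' tendsto_const_nhds hbound
    (Eventually.of_forall fun _ => zero_le) ?_
  -- `b ≥ 1` gives `log b ≥ 0`; `b ≥ A` makes each weight at most `b`, being bounded by the sum.
  filter_upwards [hb.eventually_ge_atTop (max 1 A),
    hmean.eventually (gt_mem_nhds (half_pos hε))] with n hbn hmn
  have hb1 : 1 ≤ b n := (le_max_left _ _).trans hbn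
  have hbA : A ≤ b n := (le_max_right _ _).trans hbn
  have hb0 : 0 < b n := by linarith
  have hwb : ∀ k ∈ Finset.Icc 1 n, a k n ≤ b n := fun k hk =>
    ((Finset.single_le_sum (f := fun k => a k n) (fun j hj => (hw n j hj).le) hk).trans
      (hA' n)).trans hbA
  have hE := abs_integral_sum_truncTerm_sub_le (hw n) hwb hb0
  set E := ∫ x, (∑ k ∈ Finset.Icc 1 n, truncTerm (fun k => a k n) (b n) k) x ∂lebesgue01
  set S := ∑ k ∈ Finset.Icc 1 n, a k n
  set T := ∑ k ∈ Finset.Icc 1 n, a k n * Real.log (a k n)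
  have hm : |E - b n * ℓ| ≤ b n * (ε / 2) := by
    have hl0 : 0 ≤ Real.log (b n) := Real.log_nonneg hb1
    have h1 : E - b n * ℓ = (E - (Real.log (b n) * S - T)) + Real.log (b n) * S
        - b n * (T / b n + ℓ) := by
      field_simp
      ring
    have h2 : |E - b n * ℓ| ≤ A + Real.log (b n) * A + b n * |T / b n + ℓ| := by
      rw [h1]
      refine (abs_sub _ _).trans (add_le_add ((abs_add_le _ _).trans
        (add_le_add (hE.trans (hA' n)) ?_)) ?_)
      · rw [abs_of_nonneg (mul_nonneg hl0 (hs0 n))]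
        exact mul_le_mul_of_nonneg_left (hA' n) hl0
      · rw [abs_mul, abs_of_pos hb0]
    have h3 : A + Real.log (b n) * A + b n * |T / b n + ℓ|
        = b n * (A * (b n)⁻¹ + A * (Real.log (b n) / b n) + |T / b n + ℓ|) := by
      field_simp
    rw [h3] at h2
    exact h2.trans (mul_le_mul_of_nonneg_left hmn.le hb0.le)
  have hset : {x | ε ≤ ‖1 / b n * ∑ k ∈ Finset.Icc 1 n, a k n * (lurothDigit (k + 1) x : ℝ) - ℓ‖}
      = {x | b n * ε ≤
          |∑ k ∈ Finset.Icc 1 n, a k n * (lurothDigit (k + 1) x : ℝ) - b n * ℓ|} := by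
    ext x
    simp only [Set.mem_ofPred_eq, Real.norm_eq_abs]
    have : b n * (1 / b n * ∑ k ∈ Finset.Icc 1 n, a k n * (lurothDigit (k + 1) x : ℝ) - ℓ)
        = ∑ k ∈ Finset.Icc 1 n, a k n * (lurothDigit (k + 1) x : ℝ) - b n * ℓ := by
      field_simp
    rw [← this, abs_mul, abs_of_pos hb0, mul_le_mul_iff_right₀ hb0]
  rw [hset]
  refine (lebesgue01_abs_sum_sub_ge_le (hw n) hb0 hε hm).trans
    (add_le_add (ENNReal.ofReal_le_ofReal ?_) (ENNReal.ofReal_le_ofReal ?_))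
  · rw [← div_eq_mul_inv]
    gcongr
    exact hA' n
  · calc 2 * b n * S / (b n * (ε / 2)) ^ 2 ≤ 2 * b n * A / (b n * (ε / 2)) ^ 2 := by
          gcongr
          exact hA' n
      _ = 8 * A / ε ^ 2 * (b n)⁻¹ := by
          field_simp
          ring

end

theorem mainTheorem8 :
    -- `R_n = D_{n+1} - 1` is an Oppenheim expansion, with `F_n` uniform and `α_n = 1`
    ((∀ n, 1 ≤ n → ∀ x ∈ Set.Ioc (0 : ℝ) 1,
        oppenheimR (fun _ _ => 1) (fun _ _ => 0) (fun n x => lurothDigit n x - 1) n x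
          = (lurothDigit (n + 1) x : ℝ) - 1) ∧
      IsDistributionFunction01 uniformCDF ∧
      LurothScheme (fun _ => uniformCDF) ∧
      ConditionI (fun _ => uniformCDF) (fun _ => 1) ∧
      ConditionII (fun _ => uniformCDF) (fun _ => 1)) ∧
    -- the weak law
    ∀ (F : ℕ → ℝ → ℝ) (α : ℕ → ℝ) (a : ℕ → ℕ → ℝ) (ρ : ℕ → ℝ) (ℓ : ℝ),
      (∀ n, 1 ≤ n → IsDistributionFunction01 (F n)) →
      LurothScheme F →
      ConditionI F α →
      ConditionII F α →
      WeightAssumptions α a ρ ℓ →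
      TendstoInMeasure lebesgue01
        (fun (n : ℕ) (x : ℝ) =>
          1 / (ρ n * Real.log n) * ∑ k ∈ Finset.Icc 1 n, a k n * (lurothDigit (k + 1) x : ℝ))
        atTop (fun _ => ℓ) := by
  refine ⟨⟨fun n _ x hx => ?_, isDistributionFunction01_uniformCDF, lurothScheme_uniformCDF,
    conditionI_uniformCDF, conditionII_uniformCDF⟩, fun F α a ρ ℓ hF hL hI _ hW => ?_⟩
  · have := (lurothDigit_expansion hx).1 (n + 1)
    simp [oppenheimR, Nat.cast_sub (show 1 ≤ lurothDigit (n + 1) x by omega)]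
  · have hα : ∀ k, 1 ≤ k → α k = 1 := fun k hk => hL.alpha_eq_one hI hk (hF k hk)
    -- Used with `g = Real.log` and with `g = 1` to remove `α` from the weight conditions.
    have hsum : ∀ (n : ℕ) (g : ℝ → ℝ), ∑ k ∈ Finset.Icc 1 n, α k * a k n * g (α k * a k n)
        = ∑ k ∈ Finset.Icc 1 n, a k n * g (a k n) := fun n g =>
      Finset.sum_congr rfl fun k hk => by rw [hα k (Finset.mem_Icc.1 hk).1, one_mul]
    refine tendstoInMeasure_sum_lurothDigit hW.pos hW.norm_tendsto ?_ ?_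
    · exact hW.lim_eq.congr fun n => by rw [hsum n Real.log]
    · have h1 : ∀ n, ∑ k ∈ Finset.Icc 1 n, α k * a k n = ∑ k ∈ Finset.Icc 1 n, a k n := fun n => by
        simpa only [mul_one] using hsum n fun _ => 1
      simpa only [h1] using hW.sum_bounded
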